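/- Work over $\mathbb{C}$. Let $0\le n\le 2$ and let $p_0,\dots,p_n\in\mathbb{P}^2$ be points in general position, that is, points spanned by linearly independent vectors (for $n=1$: distinct; for $n=2$: not on a line). Let $P'$ be the blow-up of $\mathbb{P}^2$ at $p_0,\dots,p_n$, with $H$ the pull-back of a line, $E_j$ the exceptional divisor over $p_j$ and $K=-3H+\sum_j E_j$ the canonical class. For integers $d,m_0,\dots,m_n\ge 0$ let $\mathcal{L}=\mathcal{L}(d,m_0,\dots,m_n)$ be the linear system of plane curves of degree $d$ having multiplicity at least $m_j$ at $p_j$ for all $j$, and let $\ell(\mathcal{L})$ be its projective dimension ($-1$ if it is empty). For a class $D=dH-\sum_j m_jE_j$ with $d,m_j\in\mathbb{Z}$ put $$v(D)=\frac{D\cdot(D-K)}{2}=\frac{d(d+3)}{2}-\sum_{j=0}^n\frac{m_j(m_j+1)}{2},$$ and $v(\mathcal{L})=v(D)$ if $D=dH-\sum_j m_jE_j$ is the class of $\mathcal{L}$. The system $\mathcal{L}$ is *special* if $\ell(\mathcal{L})>\max\{-1,v(\mathcal{L})\}$. A *$(-1)$-curve* is an irreducible curve $A\subset\mathbb{P}^2$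 whose strict transform $\tilde A\subset P'$ is smooth and rational with $\tilde A^2=-1$. The system $\mathcal{L}$ with class $D$ is *$(-1)$-special* if there are finitely many pairwise distinct $(-1)$-curves $A_1,\dots,A_t$ such that, with $n_i:=-D\cdot\tilde A_i$, one has $n_i\ge 1$ for all $i$, $n_j\ge 2$ for some $j$, and the residual class $M=D-\sum_{i=1}^t n_i\tilde A_i$ has degree $M\cdot H\ge 0$ and $v(M)\ge 0$. **Lemma (three base points).** For all integers $d,m_0,m\ge 0$ and $0\le n\le 2$, the quasi-homogeneous system $\mathcal{L}(d,m_0,m^n)=\mathcal{L}(d,m_0,m,\dots,m)$ (with $m$ repeated $n$ times) with base points $p_0,\dots,p_n$ is special if and only if it is $(-1)$-special. -/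

import Mathlib

open MvPolynomial
open scoped LinearAlgebra.Projectivization

noncomputable section

namespace PlaneCurves

/-- The projective plane over the complex numbers. -/
abbrev Plane : Type := ℙ ℂ (Fin 3 → ℂ)

/-- Ternary forms (and polynomials) over the complex numbers. -/
abbrev Form : Type := MvPolynomial (Fin 3) ℂ

/-! ### Multiplicities and linear systems -/

/-- The Taylor expansion `F (v + X)` of `F` at the vector `v`. -/
def taylor (v : Fin 3 → ℂ) : Form →ₐ[ℂ] Form :=
  aeval fun i => X i + C (v i)

/-- The order of vanishing of `F` at `v`: the least degree of a nonzero term of the Taylor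
expansion of `F` at `v` (and `⊤` if `F = 0`). -/
def vanishingOrder (F : Form) (v : Fin 3 → ℂ) : ℕ∞ :=
  ((taylor v F : Form) : MvPowerSeries (Fin 3) ℂ).order

/-- The multiplicity at the point `p` of the plane curve `F = 0`. For a form `F` the order of
vanishing is the same at all nonzero vectors that represent `p`, and it equals the order of
vanishing at `p` of a local (dehomogenized) equation of the curve. -/
def multAt (F : Form) (p : Plane) : ℕ∞ :=
  vanishingOrder F p.rep

/-- The vector space of all forms of degree `d` that have multiplicity at least `m j` at the
point `p j`, for all `j`; the linear system `L(d, m 0, …, m n)` is its projectivization. -/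
def linearSystem {n : ℕ} (p : Fin (n + 1) → Plane) (d : ℕ) (m : Fin (n + 1) → ℕ) :
    Submodule ℂ Form where
  carrier := {F | F.IsHomogeneous d ∧ ∀ j, (m j : ℕ∞) ≤ multAt F (p j)}
  zero_mem' := ⟨isHomogeneous_zero _ _ _, fun j => by
    simp [multAt, vanishingOrder]⟩
  add_mem' := fun {F G} hF hG => ⟨hF.1.add hG.1, fun j => by
    have h : min (multAt F (p j)) (multAt G (p j)) ≤ multAt (F + G) (p j) := by
      simp only [multAt, vanishingOrder, map_add, MvPolynomial.coe_add]
      exact MvPowerSeries.min_order_le_add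
    exact (le_min (hF.2 j) (hG.2 j)).trans h⟩
  smul_mem' := fun c F hF => ⟨(homogeneousSubmodule (Fin 3) ℂ d).smul_mem c hF.1, fun j => by
    have h : multAt F (p j) ≤ multAt (c • F) (p j) := by
      simp only [multAt, vanishingOrder, map_smul, MvPolynomial.coe_smul]
      exact MvPowerSeries.le_order_smul
    exact (hF.2 j).trans h⟩

/-- The space of forms in question is finite-dimensional. -/
theorem linearSystem_finite {n : ℕ} (p : Fin (n + 1) → Plane) (d : ℕ) (m : Fin (n + 1) → ℕ) :
    Module.Finite ℂ (linearSystem p d m) := by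
  have hle : linearSystem p d m ≤ homogeneousSubmodule (Fin 3) ℂ d := fun F hF => hF.1
  have hfin : Module.Finite ℂ (homogeneousSubmodule (Fin 3) ℂ d) :=
    Module.Finite.iff_fg.mpr (homogeneousSubmodule_fg (Fin 3) ℂ d)
  exact Module.Finite.of_injective (Submodule.inclusion hle) (Submodule.inclusion_injective hle)

/-- The projective dimension `ℓ` of the linear system (`-1` if the system is empty). -/
def dimension {n : ℕ} (p : Fin (n + 1) → Plane) (d : ℕ) (m : Fin (n + 1) → ℕ) : ℤ :=
  (Module.finrank ℂ (linearSystem p d m) : ℤ) - 1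

/-! ### Divisor classes on the blow-up of the plane at `n + 1` points -/

/-- Divisor classes on the blow-up of the plane at `n + 1` points: the pair `(d, m)` stands for
the class `d H - ∑ j, m j E j`, with `H` the pull-back of a line and `E j` the exceptional
divisors. -/
abbrev DivisorClass (n : ℕ) : Type := ℤ × (Fin (n + 1) → ℤ)

/-- The intersection form, given by `H ^ 2 = 1`, `H . E j = 0`, `E i . E j = 0` for `i ≠ j` and
`E j ^ 2 = -1`. -/
def inter {n : ℕ} (D D' : DivisorClass n) : ℤ :=
  D.1 * D'.1 - ∑ j, D.2 j * D'.2 j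

/-- The canonical class `K = -3 H + ∑ j, E j`. -/
def canonicalClass (n : ℕ) : DivisorClass n := (-3, fun _ => -1)

/-- The virtual dimension `v = D . (D - K) / 2`. The division is exact, see `two_mul_virtualDim`. -/
def virtualDim {n : ℕ} (D : DivisorClass n) : ℤ :=
  inter D (D - canonicalClass n) / 2

theorem two_mul_virtualDim {n : ℕ} (D : DivisorClass n) :
    2 * virtualDim D = D.1 * (D.1 + 3) - ∑ j, D.2 j * (D.2 j + 1) := by
  have h : inter D (D - canonicalClass n) = D.1 * (D.1 + 3) - ∑ j, D.2 j * (D.2 j + 1) := by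
    simp [inter, canonicalClass]
  have h1 : (2 : ℤ) ∣ D.1 * (D.1 + 3) := by
    have := (Int.even_mul_succ_self D.1).two_dvd
    have e : D.1 * (D.1 + 3) = D.1 * (D.1 + 1) + 2 * D.1 := by ring
    rw [e]
    exact dvd_add this (dvd_mul_right _ _)
  have h2 : (2 : ℤ) ∣ ∑ j, D.2 j * (D.2 j + 1) :=
    Finset.dvd_sum fun j _ => (Int.even_mul_succ_self (D.2 j)).two_dvd
  rw [virtualDim, h]
  exact Int.mul_ediv_cancel' (dvd_sub h1 h2)

/-- The expected dimension `e = max (-1) v`. -/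
def expectedDim {n : ℕ} (D : DivisorClass n) : ℤ := max (-1) (virtualDim D)

/-- The class `d H - ∑ j, m j E j` on the blow-up that belongs to the linear system
`L(d, m 0, …, m n)`. -/
def systemClass {n : ℕ} (d : ℕ) (m : Fin (n + 1) → ℕ) : DivisorClass n :=
  ((d : ℤ), fun j => (m j : ℤ))

/-- The linear system `L(d, m 0, …, m n)` with base points `p` is special. -/
def IsSpecial {n : ℕ} (p : Fin (n + 1) → Plane) (d : ℕ) (m : Fin (n + 1) → ℕ) : Prop :=
  expectedDim (systemClass d m) < dimension p d m

/-! ### Curves and their strict transforms -/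

/-- The class on the blow-up at the points `p` of the strict transform of the plane curve
`F = 0`, for a nonzero form `F`. -/
def strictTransformClass {n : ℕ} (p : Fin (n + 1) → Plane) (F : Form) : DivisorClass n :=
  ((F.totalDegree : ℤ), fun j => ((multAt F (p j)).toNat : ℤ))

/-- The pull-back of `F` to the chart `(s, t) ↦ (s, s t)` of the blow-up at the point `[v]`, in
the affine coordinates `(a, b) ↦ [v + a u + b w]` of the plane around `[v]`; here `v, u, w` is a
basis, `s = X 0` and `t = X 1`. The exceptional divisor is `s = 0` in this chart. -/
def blowUpChart (v u w : Fin 3 → ℂ) (F : Form) : MvPolynomial (Fin 2) ℂ :=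
  aeval (fun i => C (v i) + X 0 * C (u i) + X 0 * X 1 * C (w i)) F

/-- The strict transform of the curve `F = 0` under the blow-up at `q` is smooth at all its points
on the exceptional divisor: in every chart of the blow-up over `q`, if `G = 0` is the equation of
the strict transform, obtained by removing all factors `s` from the pull-back of `F`, then `G` has
no singular point on `s = 0`. (All charts are considered, so the whole exceptional divisor is
covered.) -/
def SmoothOver (q : Plane) (F : Form) : Prop :=
  ∀ u w : Fin 3 → ℂ, LinearIndependent ℂ ![q.rep, u, w] →
    ∃ (k : ℕ) (G : MvPolynomial (Fin 2) ℂ),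
      blowUpChart q.rep u w F = X 0 ^ k * G ∧ ¬ (X 0 ∣ G) ∧
      ∀ t : ℂ, eval ![0, t] G = 0 → ∃ i, eval ![0, t] (pderiv i G) ≠ 0

/-- The strict transform of the curve `F = 0` on the blow-up at the points `p` is smooth: outside
the exceptional divisors, where the blow-up is an isomorphism, the curve itself is smooth, and the
strict transform is smooth at its points on the exceptional divisors. -/
def StrictTransformSmooth {n : ℕ} (p : Fin (n + 1) → Plane) (F : Form) : Prop :=
  (∀ q : Plane, (∀ j, q ≠ p j) → eval q.rep F = 0 → ∃ i, eval q.rep (pderiv i F) ≠ 0) ∧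
    ∀ j, SmoothOver (p j) F

/-- The irreducible plane curve `F = 0` (equivalently, its strict transform) is rational: there is
a birational map from the projective line to it. The map is `t ↦ [a 0 : a 1 : a 2]` with rational
functions `a i` of `t`; its image lies on the curve, and it is birational if and only if the
pull-back of rational functions is onto, that is, if the ratios of the `a i` generate the function
field of the projective line. -/
def IsRationalCurve (F : Form) : Prop :=
  ∃ a : Fin 3 → RatFunc ℂ, aeval a F = 0 ∧
    IntermediateField.adjoin ℂ {r : RatFunc ℂ | ∃ i j, r = a i / a j} = ⊤

/-- `(-1)`-curves: irreducible plane curves whose strict transform on the blow-up at the points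
`p` is rational and smooth and has self-intersection number `-1`. -/
structure IsNegOneCurve {n : ℕ} (p : Fin (n + 1) → Plane) (F : Form) : Prop where
  homogeneous : ∃ δ, F.IsHomogeneous δ
  irreducible : Irreducible F
  rational : IsRationalCurve F
  smooth : StrictTransformSmooth p F
  self_inter : inter (strictTransformClass p F) (strictTransformClass p F) = -1

/-- The linear system `L = L(d, m 0, …, m n)` with base points `p` is `(-1)`-special: there are
distinct `(-1)`-curves `A 1, …, A t` with `L . A i = - N i`, all `N i ≥ 1` and some `N j ≥ 2`,
such that the residual system `M = L - ∑ i, N i A i` (a system of plane curves, so of degree at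
least `0`) has virtual dimension at least `0`. -/
def IsNegOneSpecial {n : ℕ} (p : Fin (n + 1) → Plane) (d : ℕ) (m : Fin (n + 1) → ℕ) : Prop :=
  ∃ (t : ℕ) (A : Fin t → Form) (N : Fin t → ℤ),
    (∀ i, IsNegOneCurve p (A i)) ∧
    (∀ i j, i ≠ j → ¬ Associated (A i) (A j)) ∧
    (∀ i, inter (systemClass d m) (strictTransformClass p (A i)) = - N i) ∧
    (∀ i, 1 ≤ N i) ∧
    (∃ j, 2 ≤ N j) ∧
    0 ≤ (systemClass d m - ∑ i, N i • strictTransformClass p (A i)).1 ∧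
    0 ≤ virtualDim (systemClass d m - ∑ i, N i • strictTransformClass p (A i))

/-- The multiplicities `(m₀, m, …, m)`, with `n` entries `m`, of the quasi-homogeneous system
`L(d, m₀, m ^ n)`. -/
def quasiHomogeneous (n m₀ m : ℕ) : Fin (n + 1) → ℕ :=
  Fin.cons m₀ fun _ => m

end PlaneCurves

end

noncomputable section

namespace PlaneCurves

/-! ### Linear changes of coordinates -/

/-! Up to three independent points become coordinate points after a linear change of coordinates.
There everything is monomial: x^s of degree d has multiplicity d - s_j at the j-th coordinate point,
and no cancellation occurs between monomials. Hence the linear system is spanned by the monomials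
with s_j + m_j ≤ d for all j (`finrank_linearSystem`), a missing point counting as multiplicity 0,
and its dimension is a count of lattice points in a triangle with its corners cut off.

If the corners neither overlap nor stick out, the count is the virtual one; in general the virtual
one is only a lower bound. Corners i and j overlap badly exactly when the line through the two
points meets the class negatively. Every monomial of the system is then divisible by the equation of
that line to the power N_k = m_i + m_j - d, and removing these fixed lines is a translation of
lattice points to a system whose count is virtual (`two_mul_card_eq_residual`). Since the lines are
disjoint (-1)-curves on the blow-up, the removal raises v by the sum of N_k(N_k - 1)/2
(`residual_sub_eq`). So a nonempty system is special precisely when some N_k ≥ 2.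

It remains to see that the (-1)-curves are exactly the lines joining two base points: any other
irreducible curve has multiplicities with pairwise sums at most its degree, which forces a
nonnegative self-intersection (`IsNegOneCurve.exists_associated`). For the converse direction the
lower bound for the residual system suffices (`le_two_mul_card_of_residual`), so the given curves
need not include all fixed lines. -/

/-- The linear form that reads off the `k`-th coordinate with respect to the basis `b`. -/
def coordForm (b : Module.Basis (Fin 3) ℂ (Fin 3 → ℂ)) (k : Fin 3) : Form :=
  ∑ i, C (b.coord k (Pi.single i 1)) * X i

/-- Substitution of coordinates with respect to the basis `b`. -/
def coordChangeHom (b : Module.Basis (Fin 3) ℂ (Fin 3 → ℂ)) : Form →ₐ[ℂ] Form :=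
  aeval fun i => ∑ k, C (b k i) * X k

theorem sum_coord_single_mul (b : Module.Basis (Fin 3) ℂ (Fin 3 → ℂ)) (k : Fin 3)
    (v : Fin 3 → ℂ) : ∑ i, b.coord k (Pi.single i 1) * v i = b.coord k v := by
  conv_rhs => rw [pi_eq_sum_univ' v]
  simp [map_sum, mul_comm]

theorem coordChangeHom_coordForm (b : Module.Basis (Fin 3) ℂ (Fin 3 → ℂ)) (k : Fin 3) :
    coordChangeHom b (coordForm b k) = X k := by
  have h (l : Fin 3) : ∑ i, C (b.coord k (Pi.single i 1)) * (C (b l i) * X l) =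
      (C (b.coord k (b l)) * X l : Form) := by
    rw [← sum_coord_single_mul, map_sum, Finset.sum_mul]
    simp [mul_assoc]
  simp only [coordForm, coordChangeHom, map_sum, map_mul, algHom_C, aeval_X, Finset.mul_sum,
    algebraMap_eq]
  rw [Finset.sum_comm]
  simp only [h]
  simp [Finsupp.single_apply]

theorem aeval_coordForm_coordChangeHom (b : Module.Basis (Fin 3) ℂ (Fin 3 → ℂ)) (i : Fin 3) :
    aeval (coordForm b) (coordChangeHom b (X i)) = (X i : Form) := by
  have h (r : Fin 3) : ∑ k, b k i * b.coord k (Pi.single r 1) = (Pi.single r 1 : Fin 3 → ℂ) i := by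
    conv_rhs => rw [← b.sum_repr (Pi.single r 1)]
    simp [mul_comm]
  simp only [coordForm, coordChangeHom, map_sum, map_mul, algHom_C, aeval_X, Finset.mul_sum,
    algebraMap_eq]
  rw [Finset.sum_comm]
  simp only [← mul_assoc, ← map_mul, ← Finset.sum_mul, ← map_sum, h]
  simp [Pi.single_apply]

/-- The change of coordinates to the basis `b`, as an automorphism of the ring of forms. -/
def coordChange (b : Module.Basis (Fin 3) ℂ (Fin 3 → ℂ)) : Form ≃ₐ[ℂ] Form :=
  AlgEquiv.ofAlgHom (coordChangeHom b) (aeval (coordForm b))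
    (by ext1 k; simpa using coordChangeHom_coordForm b k)
    (by ext1 i; simpa using aeval_coordForm_coordChangeHom b i)

theorem coordChange_coordForm (b : Module.Basis (Fin 3) ℂ (Fin 3 → ℂ)) (k : Fin 3) :
    coordChange b (coordForm b k) = X k :=
  coordChangeHom_coordForm b k

theorem coordForm_isHomogeneous (b : Module.Basis (Fin 3) ℂ (Fin 3 → ℂ)) (k : Fin 3) :
    (coordForm b k).IsHomogeneous 1 :=
  IsHomogeneous.sum _ _ _ fun i _ => by
    simpa using (isHomogeneous_C (Fin 3) _).mul (isHomogeneous_X ℂ i)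

theorem coordChange_isHomogeneous_iff (b : Module.Basis (Fin 3) ℂ (Fin 3 → ℂ)) {F : Form} {d : ℕ} :
    (coordChange b F).IsHomogeneous d ↔ F.IsHomogeneous d := by
  constructor <;> intro h
  · have := h.aeval (coordForm b) fun k => coordForm_isHomogeneous b k
    rw [one_mul] at this
    have e : aeval (coordForm b) (coordChange b F) = F := (coordChange b).symm_apply_apply F
    rwa [e] at this
  · have := h.aeval (fun i => ∑ k, C (b k i) * X k : Fin 3 → Form) (n := 1) fun i =>
      IsHomogeneous.sum _ _ _ fun k _ => by
        simpa using (isHomogeneous_C (Fin 3) _).mul (isHomogeneous_X ℂ k)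
    rwa [one_mul] at this

/-! ### Orders of vanishing in coordinates -/

theorem le_vanishingOrder_iff {F : Form} {v : Fin 3 → ℂ} {m : ℕ} :
    (m : ℕ∞) ≤ vanishingOrder F v ↔ taylor v F ∈ idealOfVars (Fin 3) ℂ ^ m := by
  rw [mem_pow_idealOfVars_iff', vanishingOrder]
  constructor
  · intro h x hx
    have := MvPowerSeries.coeff_of_lt_order (f := ((taylor v F : Form) : MvPowerSeries (Fin 3) ℂ))
      (d := x) (lt_of_lt_of_le (by exact_mod_cast hx) h)
    simpa using this
  · intro h
    exact MvPowerSeries.nat_le_order fun x hx => by simpa using h x hx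

theorem map_mem_pow_idealOfVars {f : Form →ₐ[ℂ] Form} (hf : ∀ i, f (X i) ∈ idealOfVars (Fin 3) ℂ)
    {F : Form} {m : ℕ} (hF : F ∈ idealOfVars (Fin 3) ℂ ^ m) :
    f F ∈ idealOfVars (Fin 3) ℂ ^ m := by
  have h : (idealOfVars (Fin 3) ℂ).map f ≤ idealOfVars (Fin 3) ℂ := by
    rw [Ideal.map_le_iff_le_comap, idealOfVars, Ideal.span_le]
    rintro _ ⟨i, rfl⟩
    exact hf i
  have := Ideal.mem_map_of_mem f hF
  rw [Ideal.map_pow] at this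
  exact Ideal.pow_right_mono h m this

theorem X_mem_idealOfVars (i : Fin 3) : (X i : Form) ∈ idealOfVars (Fin 3) ℂ :=
  Ideal.subset_span ⟨i, rfl⟩

theorem coordChange_mem_pow_iff (b : Module.Basis (Fin 3) ℂ (Fin 3 → ℂ)) {F : Form} {m : ℕ} :
    coordChange b F ∈ idealOfVars (Fin 3) ℂ ^ m ↔ F ∈ idealOfVars (Fin 3) ℂ ^ m := by
  constructor <;> intro h
  · have := map_mem_pow_idealOfVars (f := aeval (coordForm b)) (fun k => by
      rw [aeval_X]
      exact Ideal.sum_mem _ fun i _ => Ideal.mul_mem_left _ _ (X_mem_idealOfVars i)) h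
    have e : aeval (coordForm b) (coordChange b F) = F := (coordChange b).symm_apply_apply F
    rwa [e] at this
  · exact map_mem_pow_idealOfVars (f := coordChangeHom b) (fun i => by
      rw [coordChangeHom, aeval_X]
      exact Ideal.sum_mem _ fun i _ => Ideal.mul_mem_left _ _ (X_mem_idealOfVars i)) h

/-- The point `b j` has the `j`-th unit vector as its coordinates with respect to `b`, so
translation by one becomes translation by the other. -/
theorem coordChange_taylor (b : Module.Basis (Fin 3) ℂ (Fin 3 → ℂ)) (j : Fin 3) (F : Form) :
    coordChange b (taylor (b j) F) = taylor (Pi.single j 1) (coordChange b F) := by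
  have h : (coordChangeHom b).comp (taylor (b j)) =
      (taylor (Pi.single j 1)).comp (coordChangeHom b) := by
    ext1 i
    simp [coordChangeHom, taylor, mul_add, Finset.sum_add_distrib, Pi.single_apply]
  exact DFunLike.congr_fun h F

/-- Setting the `j`-th variable equal to `1`. -/
def dehomogenize (j : Fin 3) : Form →ₐ[ℂ] Form :=
  aeval fun i => if i = j then 1 else X i

theorem dehomogenize_monomial (j : Fin 3) (s : Fin 3 →₀ ℕ) (c : ℂ) :
    dehomogenize j (monomial s c) = monomial (s.erase j) c := by
  rw [dehomogenize, aeval_monomial, monomial_eq (s := s.erase j), algebraMap_eq,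
    Finsupp.prod_fintype _ _ (fun _ => pow_zero _), Finsupp.prod_fintype _ _ (fun _ => pow_zero _)]
  congr 1
  refine Finset.prod_congr rfl fun i _ => ?_
  by_cases h : i = j <;> simp [h]

theorem apply_add_degree_erase (j : Fin 3) (s : Fin 3 →₀ ℕ) :
    s j + (s.erase j).degree = s.degree := by
  simp only [Finsupp.degree_eq_sum, Finsupp.erase_apply]
  rw [Finset.sum_ite, ← Finset.add_sum_erase Finset.univ _ (Finset.mem_univ j)]
  simp [Finset.filter_ne']

/-- The degree recovers the exponent of the `j`-th variable from the other two, so distinct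
monomials of a form stay distinct after dehomogenizing. -/
theorem coeff_erase_dehomogenize {j : Fin 3} {F : Form} {d : ℕ} (hF : F.IsHomogeneous d)
    {s : Fin 3 →₀ ℕ} (hs : s.degree = d) :
    coeff (s.erase j) (dehomogenize j F) = coeff s F := by
  conv_lhs => rw [F.as_sum]
  simp only [map_sum, dehomogenize_monomial, coeff_sum, coeff_monomial]
  rw [Finset.sum_eq_single s]
  · simp
  · intro t ht hts
    refine if_neg fun h => hts ?_
    have htd : t.degree = d := by
      rw [Finsupp.degree_eq_weight_one]; exact hF (mem_support_iff.mp ht)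
    have e1 := apply_add_degree_erase j s
    have e2 := apply_add_degree_erase j t
    rw [← Finsupp.single_add_erase j s, ← Finsupp.single_add_erase j t, h,
      show t j = s j by rw [h] at e2; omega]
  · simp +contextual

/-- Near the `j`-th coordinate point a monomial is (1 + x_j)^(s_j) times a monomial of degree d -
s_j in the other two variables, and these do not cancel. This turns multiplicity into a condition on
each exponent separately. -/
theorem le_vanishingOrder_single_iff {j : Fin 3} {F : Form} {d m : ℕ} (hF : F.IsHomogeneous d) :
    (m : ℕ∞) ≤ vanishingOrder F (Pi.single j 1) ↔ ∀ s ∈ F.support, s j + m ≤ d := by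
  have hdeg {s : Fin 3 →₀ ℕ} (hs : s ∈ F.support) : s.degree = d := by
    rw [Finsupp.degree_eq_weight_one]; exact hF (mem_support_iff.mp hs)
  rw [le_vanishingOrder_iff]
  constructor
  · intro h s hs
    -- Setting x_j = 0 in the expansion preserves powers of the ideal and yields the
    -- dehomogenization.
    have h1 := map_mem_pow_idealOfVars
      (f := (aeval fun i => if i = j then 0 else X i : Form →ₐ[ℂ] Form)) (fun i => by
        rw [aeval_X]; split_ifs
        · exact zero_mem _
        · exact X_mem_idealOfVars i) h
    have h2 : (aeval fun i => if i = j then 0 else X i : Form →ₐ[ℂ] Form).comp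
        (taylor (Pi.single j 1)) = dehomogenize j := by
      ext1 i
      by_cases hi : i = j <;> simp [taylor, dehomogenize, hi]
    rw [← AlgHom.comp_apply, h2, mem_pow_idealOfVars_iff] at h1
    have h3 := h1 (s.erase j) (by
      rw [mem_support_iff, coeff_erase_dehomogenize hF (hdeg hs)]
      exact mem_support_iff.mp hs)
    have := apply_add_degree_erase j s
    have := hdeg hs
    omega
  · intro h
    rw [F.as_sum, map_sum]
    refine Ideal.sum_mem _ fun s hs => ?_
    have h1 : taylor (Pi.single j 1) (monomial s (coeff s F)) =
        (X j + 1) ^ s j * monomial (s.erase j) (coeff s F) := by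
      rw [taylor, aeval_monomial, monomial_eq (s := s.erase j), algebraMap_eq,
        Finsupp.prod_fintype _ _ (fun _ => pow_zero _),
        Finsupp.prod_fintype _ _ (fun _ => pow_zero _), mul_left_comm,
        ← Finset.mul_prod_erase Finset.univ _ (Finset.mem_univ j),
        ← Finset.mul_prod_erase Finset.univ (fun i => (X i : Form) ^ s.erase j i)
          (Finset.mem_univ j)]
      simp only [Pi.single_eq_same, C_1, Finsupp.erase_same, pow_zero, one_mul]
      congr 2
      refine Finset.prod_congr rfl fun i hi => ?_
      simp [Finset.ne_of_mem_erase hi]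
    rw [h1]
    refine Ideal.mul_mem_left _ _ ((monomial_mem_pow_idealOfVars_iff _ _
      (mem_support_iff.mp hs)).mpr ?_)
    have := apply_add_degree_erase j s
    have := hdeg hs
    have := h s hs
    omega

theorem le_vanishingOrder_basis_iff (b : Module.Basis (Fin 3) ℂ (Fin 3 → ℂ)) {j : Fin 3} {F : Form}
    {d m : ℕ} (hF : F.IsHomogeneous d) :
    (m : ℕ∞) ≤ vanishingOrder F (b j) ↔ ∀ s ∈ (coordChange b F).support, s j + m ≤ d := by
  rw [← le_vanishingOrder_single_iff ((coordChange_isHomogeneous_iff b).mpr hF),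
    le_vanishingOrder_iff, le_vanishingOrder_iff, ← coordChange_taylor, coordChange_mem_pow_iff]

/-! ### Counting lattice points -/

/-- The exponents of the monomials of degree `d` that have multiplicity at least `m j` at the
`j`-th coordinate point. -/
def latticePoints (d : ℕ) (m : Fin 3 → ℕ) : Finset (Fin 3 →₀ ℕ) :=
  (Finset.univ.finsuppAntidiag d).filter fun s => ∀ j, s j + m j ≤ d

theorem mem_latticePoints {d : ℕ} {m : Fin 3 → ℕ} {s : Fin 3 →₀ ℕ} :
    s ∈ latticePoints d m ↔ s 0 + s 1 + s 2 = d ∧ ∀ j, s j + m j ≤ d := by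
  simp [latticePoints, Fin.sum_univ_three]

theorem mem_finsuppAntidiag_three {d : ℕ} {s : Fin 3 →₀ ℕ} :
    s ∈ Finset.univ.finsuppAntidiag d ↔ s 0 + s 1 + s 2 = d := by
  simp [Fin.sum_univ_three]

theorem two_mul_card_finsuppAntidiag (d : ℕ) :
    2 * ((Finset.univ : Finset (Fin 3)).finsuppAntidiag d).card = (d + 1) * (d + 2) := by
  rw [Finset.card_finsuppAntidiag_nat_eq_choose, Finset.card_univ, Fintype.card_fin,
    show 3 + d - 1 = d + 2 by omega, Nat.choose_symm_add, Nat.choose_two_right,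
    Nat.mul_div_cancel' (Nat.even_mul_pred_self _).two_dvd, mul_comm]
  rfl

/-- The exponents of degree `d` of the monomials that have multiplicity less than `m` at the
`j`-th coordinate point. -/
def cornerPoints (d : ℕ) (j : Fin 3) (m : ℕ) : Finset (Fin 3 →₀ ℕ) :=
  (Finset.univ.finsuppAntidiag d).filter fun s => d < s j + m

theorem mem_cornerPoints {d : ℕ} {j : Fin 3} {m : ℕ} {s : Fin 3 →₀ ℕ} :
    s ∈ cornerPoints d j m ↔ s 0 + s 1 + s 2 = d ∧ d < s j + m := by
  rw [cornerPoints, Finset.mem_filter, mem_finsuppAntidiag_three]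

theorem two_mul_card_cornerPoints {d m : ℕ} (j : Fin 3) (h : m ≤ d + 1) :
    2 * (cornerPoints d j m).card = m * (m + 1) := by
  obtain _ | m := m
  · suffices cornerPoints d j 0 = ∅ by simp [this]
    refine Finset.eq_empty_of_forall_notMem fun s hs => ?_
    have := mem_cornerPoints.mp hs
    fin_cases j <;> simp at this <;> omega
  · rw [← two_mul_card_finsuppAntidiag]
    congr 1
    -- With multiplicity m + 1 the corner is s_j ≥ d - m, a translate of the simplex of degree m.
    refine Finset.card_nbij' (fun s => s - Finsupp.single j (d - m))
      (fun s => s + Finsupp.single j (d - m)) ?_ ?_ ?_ ?_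
    · intro s hs
      have := mem_cornerPoints.mp hs
      refine mem_finsuppAntidiag_three.mpr ?_
      fin_cases j <;> simp at this ⊢ <;> omega
    · intro s hs
      have := mem_finsuppAntidiag_three.mp hs
      refine mem_cornerPoints.mpr ?_
      fin_cases j <;> simp at this ⊢ <;> omega
    · intro s hs
      have := (mem_cornerPoints.mp hs).2
      ext i
      by_cases hi : i = j
      · subst hi; simp; omega
      · simp [Ne.symm hi]
    · intro s hs
      simp

theorem two_mul_card_cornerPoints_le (d m : ℕ) (j : Fin 3) :
    2 * (cornerPoints d j m).card ≤ m * (m + 1) := by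
  by_cases h : m ≤ d + 1
  · exact (two_mul_card_cornerPoints j h).le
  -- A multiplicity beyond d + 1 cuts off the whole simplex, which has fewer points than the virtual
  -- corner.
  · have h1 : (cornerPoints d j m).card ≤ _ := Finset.card_filter_le _ _
    have h2 := two_mul_card_finsuppAntidiag d
    nlinarith

theorem card_latticePoints_add (d : ℕ) (m : Fin 3 → ℕ) :
    (latticePoints d m).card + (Finset.univ.biUnion fun j => cornerPoints d j (m j)).card =
      ((Finset.univ : Finset (Fin 3)).finsuppAntidiag d).card := by
  have h : (Finset.univ.biUnion fun j => cornerPoints d j (m j)) =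
      (Finset.univ.finsuppAntidiag d).filter fun s => ¬ ∀ j, s j + m j ≤ d := by
    ext s
    simp [cornerPoints]
  rw [h, latticePoints, Finset.card_filter_add_card_filter_not]

theorem le_two_mul_card_latticePoints (d : ℕ) (m : Fin 3 → ℕ) :
    (d + 1) * (d + 2) ≤ 2 * (latticePoints d m).card + ∑ j, m j * (m j + 1) := by
  have h1 := card_latticePoints_add d m
  have h2 := Finset.card_biUnion_le (s := Finset.univ) (t := fun j => cornerPoints d j (m j))
  have h3 : ∑ j, 2 * (cornerPoints d j (m j)).card ≤ ∑ j, m j * (m j + 1) :=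
    Finset.sum_le_sum fun j _ => two_mul_card_cornerPoints_le d (m j) j
  rw [← Finset.mul_sum] at h3
  have h4 := two_mul_card_finsuppAntidiag d
  omega

/-- A point in corners i and j would have s_i + s_j ≥ 2(d + 1) - m_i - m_j ≥ d + 1, so the corners
are disjoint and inclusion-exclusion has no correction terms. -/
theorem two_mul_card_latticePoints {d : ℕ} {m : Fin 3 → ℕ} (h : ∀ j, m j ≤ d + 1)
    (h' : ∀ i j, i ≠ j → m i + m j ≤ d + 1) :
    2 * (latticePoints d m).card + ∑ j, m j * (m j + 1) = (d + 1) * (d + 2) := by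
  have h1 := card_latticePoints_add d m
  rw [Finset.card_biUnion] at h1
  · have h3 : ∑ j, 2 * (cornerPoints d j (m j)).card = ∑ j, m j * (m j + 1) :=
      Finset.sum_congr rfl fun j _ => two_mul_card_cornerPoints j (h j)
    rw [← Finset.mul_sum] at h3
    have h4 := two_mul_card_finsuppAntidiag d
    omega
  · intro i _ j _ hij
    refine Finset.disjoint_left.mpr fun s hi hj => ?_
    have e1 := mem_cornerPoints.mp hi
    have e2 := mem_cornerPoints.mp hj
    have e3 := h' i j hij
    fin_cases i <;> fin_cases j <;> simp at hij e1 e2 e3 <;> omega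

/-- Translation by `N` is multiplication by the product of the coordinate lines to the powers `N k`.
-/
theorem card_latticePoints_le_of_shift {d e : ℕ} {m μ : Fin 3 → ℕ} (N : Fin 3 →₀ ℕ)
    (he : e + (N 0 + N 1 + N 2) = d) (h : ∀ j, N j + m j + e ≤ d + μ j) :
    (latticePoints e μ).card ≤ (latticePoints d m).card := by
  refine Finset.card_le_card_of_injOn (· + N) (fun s hs => ?_) ((add_left_injective N).injOn)
  obtain ⟨h1, h2⟩ := mem_latticePoints.mp hs
  refine mem_latticePoints.mpr ⟨by simp; omega, fun j => ?_⟩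
  have := h2 j
  have := h j
  simp; omega

theorem card_latticePoints_eq_of_shift {d e : ℕ} {m μ : Fin 3 → ℕ} (N : Fin 3 →₀ ℕ)
    (he : e + (N 0 + N 1 + N 2) = d) (h : ∀ j, N j + m j + e = d + μ j)
    (hN : ∀ s ∈ latticePoints d m, ∀ j, N j ≤ s j) :
    (latticePoints e μ).card = (latticePoints d m).card := by
  refine (card_latticePoints_le_of_shift N he fun j => (h j).le).antisymm
    (Finset.card_le_card_of_injOn (· - N) (fun s hs => ?_) fun s hs t ht hst => ?_)
  · obtain ⟨h1, h2⟩ := mem_latticePoints.mp hs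
    have h3 := hN s hs
    have := h3 0
    have := h3 1
    have := h3 2
    refine mem_latticePoints.mpr ⟨by simp; omega, fun j => ?_⟩
    have := h2 j
    have := h j
    have := h3 j
    simp; omega
  · ext j
    have := hN s hs j
    have := hN t ht j
    have := DFunLike.congr_fun hst j
    simp at this
    omega

/-- The number of lattice points is at least the virtual one of the residual class after removal of
the `k`-th coordinate line `N k` times. -/
theorem le_two_mul_card_of_residual {d : ℕ} {m : Fin 3 → ℕ} (N : Fin 3 →₀ ℕ)
    (hd : N 0 + N 1 + N 2 ≤ d) :
    ((d : ℤ) - ∑ k, (N k : ℤ)) * ((d : ℤ) - ∑ k, (N k : ℤ) + 3) -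
        ∑ j, ((m j : ℤ) - (∑ k, (N k : ℤ) - N j)) * ((m j : ℤ) - (∑ k, (N k : ℤ) - N j) + 1) + 2 ≤
      2 * ((latticePoints d m).card : ℤ) := by
  obtain ⟨e, rfl⟩ := Nat.exists_eq_add_of_le' hd
  -- Residual multiplicities may be negative and are truncated to 0. This does not lower the virtual
  -- count, because x(x + 1) ≥ 0 for every integer x ≤ 0.
  set μ : Fin 3 → ℕ := fun j => ((m j : ℤ) - (∑ k, (N k : ℤ) - N j)).toNat with hμ
  have h1 := card_latticePoints_le_of_shift (d := e + (N 0 + N 1 + N 2)) (m := m) (μ := μ) N rfl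
    (fun j => by
      have : (m j : ℤ) - (∑ k, (N k : ℤ) - N j) ≤ μ j := Int.self_le_toNat _
      simp only [Fin.sum_univ_three] at this
      omega)
  have h2 := le_two_mul_card_latticePoints e μ
  have h3 (j : Fin 3) : (μ j : ℤ) * (μ j + 1) ≤
      ((m j : ℤ) - (∑ k, (N k : ℤ) - N j)) * ((m j : ℤ) - (∑ k, (N k : ℤ) - N j) + 1) := by
    simp only [hμ]
    rcases le_total 0 ((m j : ℤ) - (∑ k, (N k : ℤ) - N j)) with h | h
    · rw [Int.toNat_of_nonneg h]
    · rw [Int.toNat_of_nonpos h]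
      rcases h.eq_or_lt with h | h
      · rw [h]; simp
      · push_cast
        nlinarith
  have h4 := Finset.sum_le_sum fun j (_ : j ∈ Finset.univ) => h3 j
  have h5 : (((e + 1) * (e + 2) : ℕ) : ℤ) ≤
      (2 * (latticePoints e μ).card + ∑ j, μ j * (μ j + 1) : ℕ) := by exact_mod_cast h2
  push_cast at h5
  have h6 : ((e + (N 0 + N 1 + N 2) : ℕ) : ℤ) - ∑ k, (N k : ℤ) = e := by
    simp [Fin.sum_univ_three]
  rw [h6]
  have h7 : ((latticePoints e μ).card : ℤ) ≤ (latticePoints (e + (N 0 + N 1 + N 2)) m).card := by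
    exact_mod_cast h1
  linarith

/-- The negative of the intersection number of the class with the `k`-th coordinate line, or `0` if
this is negative. -/
def fixedMultiplicity (d : ℕ) (m : Fin 3 → ℕ) : Fin 3 →₀ ℕ :=
  Finsupp.equivFunOnFinite.symm fun k => m 0 + m 1 + m 2 - m k - d

theorem two_mul_card_eq_residual {d : ℕ} {m : Fin 3 → ℕ} (h : (latticePoints d m).Nonempty)
    (N : Fin 3 →₀ ℕ) (hN : N = fixedMultiplicity d m) :
    N 0 + N 1 + N 2 ≤ d ∧
    ((d : ℤ) - ∑ k, (N k : ℤ)) * ((d : ℤ) - ∑ k, (N k : ℤ) + 3) -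
        ∑ j, ((m j : ℤ) - (∑ k, (N k : ℤ) - N j)) * ((m j : ℤ) - (∑ k, (N k : ℤ) - N j) + 1) + 2 =
      2 * ((latticePoints d m).card : ℤ) := by
  have hN0 : N 0 = m 1 + m 2 - d := by subst hN; simp [fixedMultiplicity]; omega
  have hN1 : N 1 = m 0 + m 2 - d := by subst hN; simp [fixedMultiplicity]; omega
  have hN2 : N 2 = m 0 + m 1 - d := by subst hN; simp [fixedMultiplicity]
  -- The bounds s_i ≤ d - m_i and s_j ≤ d - m_j leave s_k ≥ m_i + m_j - d: the line is a fixed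
  -- component with this multiplicity.
  have hle (s) (hs : s ∈ latticePoints d m) (j : Fin 3) : N j ≤ s j := by
    obtain ⟨h1, h2⟩ := mem_latticePoints.mp hs
    have := h2 0
    have := h2 1
    have := h2 2
    fin_cases j <;> simp <;> omega
  obtain ⟨s, hs⟩ := h
  obtain ⟨h1, h2⟩ := mem_latticePoints.mp hs
  have a0 := h2 0
  have a1 := h2 1
  have a2 := h2 2
  have b0 := hle s hs 0
  have b1 := hle s hs 1
  have b2 := hle s hs 2
  have hd : N 0 + N 1 + N 2 ≤ d := by omega
  refine ⟨hd, ?_⟩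
  obtain ⟨e, he⟩ := Nat.exists_eq_add_of_le' hd
  -- When both lines through the point are removed, this is m_0 + m_1 + m_2 ≤ 2d, which follows by
  -- adding the three bounds on the exponents of `s`.
  have hpos (j : Fin 3) : 0 ≤ (m j : ℤ) - (∑ k, (N k : ℤ) - N j) := by
    fin_cases j <;> simp [Fin.sum_univ_three] <;> omega
  choose μ hμ using fun j => Int.eq_ofNat_of_zero_le (hpos j)
  have m0 := hμ 0
  have m1 := hμ 1
  have m2 := hμ 2
  simp only [Fin.sum_univ_three] at m0 m1 m2
  rw [← card_latticePoints_eq_of_shift (e := e) (μ := μ) N he.symm (fun j => by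
    fin_cases j <;> simp <;> omega) hle]
  -- The residual class satisfies μ_i + μ_j - e = m_i + m_j - d - N_k ≤ 0, so its corners are
  -- disjoint.
  have h5 := two_mul_card_latticePoints (d := e) (m := μ) (fun j => by
    fin_cases j <;> simp <;> omega) (fun i j hij => by
    fin_cases i <;> fin_cases j <;> simp at hij ⊢ <;> omega)
  have h6 : (d : ℤ) - ∑ k, (N k : ℤ) = e := by
    simp [Fin.sum_univ_three]; omega
  simp only [hμ, h6]
  have h7 : ((2 * (latticePoints e μ).card + ∑ j, μ j * (μ j + 1) : ℕ) : ℤ) =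
    ((e + 1) * (e + 2) : ℕ) := by rw [h5]
  push_cast at h7
  linarith

/-- The three lines are pairwise orthogonal with A² = A·K = -1, so removing A with multiplicity N =
-D·A changes 2v by 2N² - N² - N. A line with N = 0 contributes nothing, whatever its intersection
number. -/
theorem residual_sub_eq {d : ℤ} {m N : Fin 3 → ℤ}
    (hN : ∀ k, N k = 0 ∨ N k = ∑ j, m j - m k - d) :
    (d - ∑ k, N k) * (d - ∑ k, N k + 3) -
        ∑ j, (m j - (∑ k, N k - N j)) * (m j - (∑ k, N k - N j) + 1) =
      d * (d + 3) - ∑ j, m j * (m j + 1) + ∑ k, N k * (N k - 1) := by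
  have h (k) : N k * (N k - (∑ j, m j - m k - d)) = 0 := by
    rcases hN k with h | h <;> rw [h] <;> ring
  have h0 := h 0
  have h1 := h 1
  have h2 := h 2
  simp only [Fin.sum_univ_three] at *
  linear_combination (-2) * h0 - 2 * h1 - 2 * h2

/-! ### Linear systems with base points in linearly general position -/

theorem exists_basis_extending {n : ℕ} (hn : n + 1 ≤ 3) {v : Fin (n + 1) → Fin 3 → ℂ}
    (hv : LinearIndependent ℂ v) :
    ∃ b : Module.Basis (Fin 3) ℂ (Fin 3 → ℂ), ∀ j, b (Fin.castLE hn j) = v j := by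
  suffices ∃ w : Fin 3 → Fin 3 → ℂ, LinearIndependent ℂ w ∧ ∀ j, w (Fin.castLE hn j) = v j by
    obtain ⟨w, hw, h⟩ := this
    exact ⟨basisOfLinearIndependentOfCardEqFinrank hw (by simp), by simpa using h⟩
  obtain ⟨r, hr⟩ := Nat.exists_eq_add_of_le hn
  induction r generalizing n with
  | zero =>
    obtain rfl : n = 2 := by omega
    exact ⟨v, hv, fun j => rfl⟩
  | succ r ih =>
    obtain ⟨x, hx⟩ := exists_linearIndependent_snoc_of_lt_finrank hv (by simp; omega)
    obtain ⟨w, hw, h⟩ := ih (n := n + 1) (by omega) hx (by omega)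
    refine ⟨w, hw, fun j => ?_⟩
    have := h j.castSucc
    rw [Fin.snoc_castSucc] at this
    exact this

/-- The extension by zero of a family of multiplicities to three points. -/
def extendZero {n : ℕ} {M : Type*} [Zero M] (m : Fin (n + 1) → M) (j : Fin 3) : M :=
  if h : (j : ℕ) < n + 1 then m ⟨j, h⟩ else 0

theorem sum_extendZero {n : ℕ} (hn : n + 1 ≤ 3) {M N : Type*} [Zero M] [AddCommMonoid N]
    (m : Fin (n + 1) → M) (f : M → N) (hf : f 0 = 0) :
    ∑ j, f (extendZero m j) = ∑ j, f (m j) := by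
  obtain rfl | rfl | rfl : n = 0 ∨ n = 1 ∨ n = 2 := by omega
  all_goals simp [Fin.sum_univ_succ, extendZero, hf]

theorem extendZero_castLE {n : ℕ} (hn : n + 1 ≤ 3) {M : Type*} [Zero M] (m : Fin (n + 1) → M)
    (j : Fin (n + 1)) : extendZero m (Fin.castLE hn j) = m j := by
  have h : ((Fin.castLE hn j : Fin 3) : ℕ) < n + 1 := j.2
  rw [extendZero, dif_pos h]
  rfl

section BasePoints

variable {n : ℕ} (hn : n + 1 ≤ 3) (p : Fin (n + 1) → Plane)
  (b : Module.Basis (Fin 3) ℂ (Fin 3 → ℂ)) (hb : ∀ j, b (Fin.castLE hn j) = (p j).rep)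

include hb in
theorem le_multAt_iff {F : Form} {d m : ℕ} (hF : F.IsHomogeneous d) (j : Fin (n + 1)) :
    (m : ℕ∞) ≤ multAt F (p j) ↔
      ∀ s ∈ (coordChange b F).support, s (Fin.castLE hn j) + m ≤ d := by
  rw [multAt, ← hb, le_vanishingOrder_basis_iff b hF]

theorem sum_eq_of_mem_support {F : Form} {d : ℕ} (hF : F.IsHomogeneous d) {s : Fin 3 →₀ ℕ}
    (hs : s ∈ F.support) : s 0 + s 1 + s 2 = d := by
  have : s.degree = d := by
    rw [Finsupp.degree_eq_weight_one]; exact hF (mem_support_iff.mp hs)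
  rw [← this, Finsupp.degree_eq_sum, Fin.sum_univ_three]

include hb in
theorem finrank_linearSystem (d : ℕ) (m : Fin (n + 1) → ℕ) :
    Module.finrank ℂ (linearSystem p d m) = (latticePoints d (extendZero m)).card := by
  have h : (linearSystem p d m).map (coordChange b).toLinearEquiv.toLinearMap =
      restrictSupport ℂ (latticePoints d (extendZero m) : Set (Fin 3 →₀ ℕ)) := by
    ext G
    obtain ⟨F, rfl⟩ := (coordChange b).surjective G
    have : (coordChange b F) ∈ (linearSystem p d m).map (coordChange b).toLinearEquiv.toLinearMap ↔
        F ∈ linearSystem p d m := by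
      simp
    rw [this, mem_restrictSupport_iff]
    constructor
    · rintro ⟨hF, hm⟩ s hs
      refine mem_latticePoints.mpr
        ⟨sum_eq_of_mem_support ((coordChange_isHomogeneous_iff b).mpr hF) hs, fun j => ?_⟩
      by_cases hj : (j : ℕ) < n + 1
      · have := (le_multAt_iff hn p b hb hF ⟨j, hj⟩).mp (hm ⟨j, hj⟩) s hs
        simpa [extendZero, hj] using this
      · have := sum_eq_of_mem_support ((coordChange_isHomogeneous_iff b).mpr hF) hs
        simp only [extendZero, hj, dite_false]
        fin_cases j <;> simp <;> omega
    · intro hs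
      have hF : F.IsHomogeneous d := by
        rw [← coordChange_isHomogeneous_iff b]
        intro s hc
        have := (mem_latticePoints.mp (hs (mem_support_iff.mpr hc))).1
        have h' : s.degree = d := by rw [Finsupp.degree_eq_sum, Fin.sum_univ_three, this]
        rwa [Finsupp.degree_eq_weight_one] at h'
      refine ⟨hF, fun j => (le_multAt_iff hn p b hb hF j).mpr fun s h => ?_⟩
      have := (mem_latticePoints.mp (hs h)).2 (Fin.castLE hn j)
      rwa [extendZero_castLE hn] at this
  rw [← LinearEquiv.finrank_map_eq (coordChange b).toLinearEquiv, h,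
    Module.finrank_eq_card_basis (basisRestrictSupport ℂ _)]
  simp

/-! ### Lines through two of the base points -/

/-- The class of the line on which the `k`-th coordinate vanishes. -/
def lineClass (n : ℕ) (hn : n + 1 ≤ 3) (k : Fin 3) : DivisorClass n :=
  (1, fun j => if Fin.castLE hn j = k then 0 else 1)

include hb in
theorem strictTransformClass_of_associated {F : Form} {k : Fin 3}
    (h : Associated F (coordForm b k)) : strictTransformClass p F = lineClass n hn k := by
  have hF : F.IsHomogeneous 1 := by
    obtain ⟨u, hu⟩ := h.symm
    obtain ⟨c, -, hc⟩ := MvPolynomial.isUnit_iff_eq_C_of_isReduced.mp u.isUnit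
    rw [← hu, hc]
    simpa using (coordForm_isHomogeneous b k).mul (isHomogeneous_C _ c)
  have hs : (coordChange b F).support = {Finsupp.single k 1} := by
    have h' := h.map (coordChange b : Form →* Form)
    simp only [MonoidHom.coe_coe, coordChange_coordForm] at h'
    obtain ⟨u, hu⟩ := h'.symm
    obtain ⟨c, hc, hc'⟩ := MvPolynomial.isUnit_iff_eq_C_of_isReduced.mp u.isUnit
    rw [← hu, hc', mul_comm, C_mul_X_eq_monomial, support_monomial, if_neg hc.ne_zero]
  have h0 : F ≠ 0 := by
    rintro rfl
    simp at hs
  refine Prod.ext ?_ (funext fun j => ?_)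
  · simp [strictTransformClass, lineClass, hF.totalDegree h0]
  · have hm (m : ℕ) := le_multAt_iff hn p b hb (m := m) hF j
    simp only [hs, Finset.mem_singleton, forall_eq] at hm
    have : multAt F (p j) = ((if Fin.castLE hn j = k then 0 else 1 : ℕ) : ℕ∞) := by
      refine ENat.eq_of_forall_natCast_le_iff fun m => ?_
      rw [hm, Nat.cast_le]
      split_ifs with hk
      · simp [hk]
      · simp [Ne.symm hk]
    simp only [strictTransformClass, lineClass, this]
    split_ifs <;> simp

/-- The coordinate line `k` joins two of the base points. -/
def JoinsBasePoints (n : ℕ) (k : Fin 3) : Prop := ∀ j : Fin 3, j ≠ k → (j : ℕ) < n + 1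

theorem X_dvd_of_forall_support {G : Form} {k : Fin 3} (h : ∀ s ∈ G.support, s k ≠ 0) :
    X k ∣ G := by
  rw [G.as_sum]
  refine Finset.dvd_sum fun s hs => ?_
  rw [X_dvd_monomial]
  exact Or.inr (h s hs)

include hb in
-- Bézout for an irreducible curve other than the line through two base points bounds the sum of its
-- multiplicities there by its degree. These bounds contradict self-intersection -1.
theorem IsNegOneCurve.exists_associated {F : Form} (hF : IsNegOneCurve p F) :
    ∃ k, JoinsBasePoints n k ∧ Associated F (coordForm b k) := by
  obtain ⟨e, he⟩ := hF.homogeneous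
  have h0 : coordChange b F ≠ 0 := by
    simpa using hF.irreducible.ne_zero
  by_contra! hno
  -- A monomial free of x_k exists because the line does not divide the curve; its exponents prove
  -- the Bézout inequality.
  have hex (k) (hk : JoinsBasePoints n k) : ∃ s ∈ (coordChange b F).support, s k = 0 := by
    by_contra! hs
    refine hno k hk ?_
    have h1 : coordForm b k ∣ F := by
      have := map_dvd (coordChange b).symm (X_dvd_of_forall_support hs)
      rwa [← coordChange_coordForm b k, AlgEquiv.symm_apply_apply, AlgEquiv.symm_apply_apply]
        at this
    have h2 : Prime (coordForm b k) := by
      rw [← MulEquiv.prime_iff (coordChange b), coordChange_coordForm]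
      exact X_prime
    exact (h2.irreducible.associated_of_dvd hF.irreducible h1).symm
  have hd := he.totalDegree hF.irreducible.ne_zero
  have hself := hF.self_inter
  have hmult (j : Fin (n + 1)) (s) (hs : s ∈ (coordChange b F).support) :
      s (Fin.castLE hn j) + (multAt F (p j)).toNat ≤ e := by
    refine (le_multAt_iff hn p b hb he j).mp (ENat.natCast_toNat_le_self _) s hs
  have hdeg (s) (hs : s ∈ (coordChange b F).support) :=
    sum_eq_of_mem_support ((coordChange_isHomogeneous_iff b).mpr he) hs
  obtain ⟨s, hs⟩ := support_nonempty.mpr h0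
  simp only [inter, strictTransformClass, hd] at hself
  obtain rfl | rfl | rfl : n = 0 ∨ n = 1 ∨ n = 2 := by omega
  · have h1 := hmult 0 s hs
    simp only [Fin.sum_univ_succ] at hself
    simp at hself
    have : ((multAt F (p 0)).toNat : ℤ) ≤ e := by omega
    nlinarith
  · obtain ⟨t, ht, ht0⟩ := hex 2 (fun j hj => by fin_cases j <;> simp at hj ⊢)
    have h1 : t 0 + _ ≤ _ := hmult 0 t ht
    have h2 : t 1 + _ ≤ _ := hmult 1 t ht
    have h3 := hdeg t ht
    simp only [Fin.sum_univ_succ] at hself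
    simp at hself
    set x := (multAt F (p 0)).toNat
    set y := (multAt F (p 1)).toNat
    have : (x : ℤ) + y ≤ e := by omega
    nlinarith [mul_nonneg (Int.natCast_nonneg x) (Int.natCast_nonneg y)]
  · have hpair (i j k : Fin 3) (hij : i ≠ j) (hik : i ≠ k) (hjk : j ≠ k) :
        ((multAt F (p i)).toNat : ℤ) + (multAt F (p j)).toNat ≤ e := by
      obtain ⟨t, ht, ht0⟩ := hex k (fun j hj => j.2)
      have h1 : t i + _ ≤ _ := hmult i t ht
      have h2 : t j + _ ≤ _ := hmult j t ht
      have h3 := hdeg t ht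
      fin_cases i <;> fin_cases j <;> fin_cases k <;> simp at * <;> omega
    have h01 := hpair 0 1 2 (by decide) (by decide) (by decide)
    have h02 := hpair 0 2 1 (by decide) (by decide) (by decide)
    have h12 := hpair 1 2 0 (by decide) (by decide) (by decide)
    have hx := Int.natCast_nonneg (multAt F (p 0)).toNat
    have hy := Int.natCast_nonneg (multAt F (p 1)).toNat
    have hz := Int.natCast_nonneg (multAt F (p 2)).toNat
    rw [Fin.sum_univ_three] at hself
    generalize ((multAt F (p 0)).toNat : ℤ) = x at *
    generalize ((multAt F (p 1)).toNat : ℤ) = y at *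
    generalize ((multAt F (p 2)).toNat : ℤ) = z at *
    -- With `z` the smallest multiplicity, x² + y² + z² ≤ x² + y² + xy ≤ (x + y)² ≤ e².
    have key {x y z : ℤ} (hx : 0 ≤ x) (hy : 0 ≤ y) (hz : 0 ≤ z) (h1 : z ≤ x) (h2 : z ≤ y)
        (h : x + y ≤ e) : x * x + y * y + z * z ≤ e * e := by
      have := mul_le_mul h1 h2 hz hx
      have := mul_le_mul h h (add_nonneg hx hy) (by linarith)
      nlinarith
    rcases le_total x y with h1 | h1 <;> rcases le_total y z with h2 | h2 <;>
      rcases le_total x z with h3 | h3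
    · linarith [key hy hz hx h1 h3 h12]
    · linarith [key hy hz hx h1 (h1.trans h2) h12]
    · linarith [key hy hz hx h1 h3 h12]
    · linarith [key hx hy hz h3 h2 h01]
    · linarith [key hx hz hy h1 h2 h02]
    · linarith [key hx hz hy h1 h2 h02]
    · linarith [key hx hy hz (h2.trans h1) h2 h01]
    · linarith [key hx hy hz h3 h2 h01]

end BasePoints

/-! ### The lines through two base points are `(-1)`-curves -/

theorem eval_coordForm (b : Module.Basis (Fin 3) ℂ (Fin 3 → ℂ)) (k : Fin 3) (v : Fin 3 → ℂ) :
    eval v (coordForm b k) = b.coord k v := by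
  simp only [coordForm, map_sum, map_mul, eval_C, eval_X, sum_coord_single_mul]

theorem pderiv_coordForm (b : Module.Basis (Fin 3) ℂ (Fin 3 → ℂ)) (k i : Fin 3) :
    pderiv i (coordForm b k) = C (b.coord k (Pi.single i 1)) := by
  simp only [coordForm, map_sum, pderiv_C_mul, pderiv_X, Pi.single_apply]
  simp

theorem blowUpChart_coordForm (b : Module.Basis (Fin 3) ℂ (Fin 3 → ℂ)) (k : Fin 3)
    (v u w : Fin 3 → ℂ) : blowUpChart v u w (coordForm b k) =
      C (b.coord k v) + X 0 * C (b.coord k u) + X 0 * X 1 * C (b.coord k w) := by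
  rw [← sum_coord_single_mul b k v, ← sum_coord_single_mul b k u, ← sum_coord_single_mul b k w]
  simp only [blowUpChart, coordForm, map_sum, map_mul, algHom_C, aeval_X, algebraMap_eq,
    Finset.mul_sum, ← Finset.sum_add_distrib]
  exact Finset.sum_congr rfl fun i _ => by ring

theorem exists_coord_single_ne_zero (b : Module.Basis (Fin 3) ℂ (Fin 3 → ℂ)) (k : Fin 3) :
    ∃ i, b.coord k (Pi.single i 1) ≠ 0 := by
  by_contra! h
  have := sum_coord_single_mul b k (b k)
  simp [h] at this

/-- The pull-back of the linear form λ is λ(q) + s(λ(u) + tλ(w)). On the line, one factor s splits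
off and leaves a nonzero polynomial of degree at most 1 in t; off the line, nothing vanishes on s =
0. -/
theorem smoothOver_coordForm (b : Module.Basis (Fin 3) ℂ (Fin 3 → ℂ)) (k : Fin 3) (q : Plane) :
    SmoothOver q (coordForm b k) := by
  intro u w hli
  rw [blowUpChart_coordForm]
  by_cases hq : b.coord k q.rep = 0
  · have huw : b.coord k u ≠ 0 ∨ b.coord k w ≠ 0 := by
      by_contra! h
      have hspan : Submodule.span ℂ (Set.range ![q.rep, u, w]) = ⊤ :=
        hli.span_eq_top_of_card_eq_finrank' (by simp)
      have hle : Submodule.span ℂ (Set.range ![q.rep, u, w]) ≤ LinearMap.ker (b.coord k) := by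
        rw [Submodule.span_le]
        rintro _ ⟨i, rfl⟩
        fin_cases i
        exacts [hq, h.1, h.2]
      rw [hspan] at hle
      have : b.coord k (b k) = 0 := hle (Submodule.mem_top (x := b k))
      simp at this
    refine ⟨1, C (b.coord k u) + X 1 * C (b.coord k w), by rw [hq]; simp; ring, ?_, ?_⟩
    · rintro ⟨H, hH⟩
      have h0 := congrArg (eval ![0, 0]) hH
      have h1 := congrArg (eval ![0, 1]) hH
      simp only [map_add, map_mul, eval_C, eval_X, Matrix.cons_val_zero, Matrix.cons_val_one,
        zero_mul, add_zero, one_mul] at h0 h1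
      rw [h0, zero_add] at h1
      exact huw.elim (fun h => h h0) (fun h => h h1)
    · intro t ht
      refine ⟨1, ?_⟩
      simp only [map_add, map_mul, eval_C, eval_X, Matrix.cons_val_one] at ht
      rw [mul_comm, map_add, pderiv_C, pderiv_C_mul, pderiv_X_self, zero_add, mul_one,
        eval_C]
      intro hw
      rw [hw, mul_zero, add_zero] at ht
      exact huw.elim (fun h => h ht) (fun h => h hw)
  · refine ⟨0, _, (by rw [pow_zero, one_mul]), ?_, fun t ht => absurd ?_ hq⟩
    · rintro ⟨H, hH⟩
      have h0 := congrArg (eval ![0, 0]) hH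
      simp only [map_add, map_mul, eval_C, eval_X, Matrix.cons_val_zero, zero_mul, add_zero] at h0
      exact hq h0
    · simpa only [map_add, map_mul, eval_C, eval_X, Matrix.cons_val_zero, zero_mul, add_zero]
        using ht

theorem ratFunc_linear_ne_zero {γ δ : ℂ} (h : γ ≠ 0 ∨ δ ≠ 0) :
    (RatFunc.C γ + RatFunc.C δ * RatFunc.X : RatFunc ℂ) ≠ 0 := by
  intro h0
  have h1 : algebraMap (Polynomial ℂ) (RatFunc ℂ)
      (Polynomial.C γ + Polynomial.C δ * Polynomial.X) = 0 := by
    simpa [RatFunc.algebraMap_C, RatFunc.algebraMap_X] using h0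
  rw [map_eq_zero_iff _ (RatFunc.algebraMap_injective ℂ)] at h1
  have e0 := congrArg (Polynomial.coeff · 0) h1
  have e1 := congrArg (Polynomial.coeff · 1) h1
  simp [Polynomial.coeff_C] at e0 e1
  exact h.elim (fun h => h e0) (fun h => h e1)

/-- The line is parametrized by b_i + T b_j. Some 2×2 minor of these vectors is nonzero, so a ratio
of two coordinates is an invertible Möbius function of T and generates the function field. -/
theorem isRationalCurve_coordForm (b : Module.Basis (Fin 3) ℂ (Fin 3 → ℂ)) (k : Fin 3) :
    IsRationalCurve (coordForm b k) := by
  obtain ⟨i, j, hik, hjk, hij⟩ : ∃ i j : Fin 3, i ≠ k ∧ j ≠ k ∧ i ≠ j := by decide +revert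
  obtain ⟨r, s, hrs⟩ : ∃ r s, b i r * b j s - b i s * b j r ≠ 0 := by
    by_contra! h
    refine b.ne_zero i (funext fun s => ?_)
    have h1 : b j s • b i - b i s • b j = 0 := funext fun r => by simpa [mul_comm] using h r s
    have h2 := congrArg (b.coord j) h1
    simpa [Finsupp.single_apply, hij] using h2
  refine ⟨fun r => RatFunc.C (b i r) + RatFunc.C (b j r) * RatFunc.X, ?_, ?_⟩
  · have h (v : Fin 3 → ℂ) : ∑ r, RatFunc.C (b.coord k (Pi.single r 1)) * RatFunc.C (v r) =
        RatFunc.C (b.coord k v) := by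
      rw [← sum_coord_single_mul, map_sum]
      simp only [map_mul]
    simp only [coordForm, map_sum, map_mul, algHom_C, aeval_X, RatFunc.algebraMap_eq_C, mul_add,
      Finset.sum_add_distrib, h, ← mul_assoc, ← Finset.sum_mul]
    simp [hik, hjk]
  · rw [eq_top_iff, ← RatFunc.adjoin_X, IntermediateField.adjoin_simple_le_iff]
    set S : IntermediateField ℂ (RatFunc ℂ) := IntermediateField.adjoin ℂ _
    set α := b i r
    set β := b j r
    set γ := b i s
    set δ := b j s
    have hden : (RatFunc.C γ + RatFunc.C δ * RatFunc.X : RatFunc ℂ) ≠ 0 :=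
      ratFunc_linear_ne_zero (by
        by_contra! h
        simp [h.1, h.2] at hrs)
    set ρ : RatFunc ℂ := (RatFunc.C α + RatFunc.C β * RatFunc.X) /
      (RatFunc.C γ + RatFunc.C δ * RatFunc.X)
    have hρ : ρ * (RatFunc.C γ + RatFunc.C δ * RatFunc.X) =
        RatFunc.C α + RatFunc.C β * RatFunc.X := div_mul_cancel₀ _ hden
    have hmem : ρ ∈ S := IntermediateField.subset_adjoin _ _ ⟨r, s, rfl⟩
    have hC (c : ℂ) : RatFunc.C c ∈ S := by
      rw [← RatFunc.algebraMap_eq_C]; exact S.algebraMap_mem c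
    have hne : RatFunc.C β - RatFunc.C δ * ρ ≠ 0 := by
      have : RatFunc.C β - RatFunc.C δ * ρ = RatFunc.C (γ * β - α * δ) /
          (RatFunc.C γ + RatFunc.C δ * RatFunc.X) := by
        rw [eq_div_iff hden]
        simp only [map_sub, map_mul]
        linear_combination -RatFunc.C δ * hρ
      rw [this]
      refine div_ne_zero ?_ hden
      rw [map_ne_zero]
      exact fun h => hrs (by linear_combination -h)
    have hX : RatFunc.X = (RatFunc.C γ * ρ - RatFunc.C α) / (RatFunc.C β - RatFunc.C δ * ρ) := by
      rw [eq_div_iff hne]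
      linear_combination -hρ
    rw [hX]
    exact S.div_mem (S.sub_mem (S.mul_mem (hC _) hmem) (hC _))
      (S.sub_mem (hC _) (S.mul_mem (hC _) hmem))

theorem inter_lineClass_self {n : ℕ} (hn : n + 1 ≤ 3) {k : Fin 3} (hk : JoinsBasePoints n k) :
    inter (lineClass n hn k) (lineClass n hn k) = -1 := by
  unfold JoinsBasePoints at hk
  obtain rfl | rfl | rfl : n = 0 ∨ n = 1 ∨ n = 2 := by omega
  all_goals
    revert hk
    fin_cases k <;>
      simp [inter, lineClass, Fin.sum_univ_succ, Fin.forall_fin_succ]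

theorem isNegOneCurve_coordForm {n : ℕ} (hn : n + 1 ≤ 3) (p : Fin (n + 1) → Plane)
    (b : Module.Basis (Fin 3) ℂ (Fin 3 → ℂ)) (hb : ∀ j, b (Fin.castLE hn j) = (p j).rep)
    {k : Fin 3} (hk : JoinsBasePoints n k) : IsNegOneCurve p (coordForm b k) where
  homogeneous := ⟨1, coordForm_isHomogeneous b k⟩
  irreducible := by
    rw [← MulEquiv.irreducible_iff (coordChange b), coordChange_coordForm]
    exact X_prime.irreducible
  rational := isRationalCurve_coordForm b k
  smooth := by
    refine ⟨fun q _ _ => ?_, fun j => smoothOver_coordForm b k (p j)⟩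
    obtain ⟨i, hi⟩ := exists_coord_single_ne_zero b k
    exact ⟨i, by rwa [pderiv_coordForm, eval_C]⟩
  self_inter := by
    rw [strictTransformClass_of_associated hn p b hb (Associated.refl _)]
    exact inter_lineClass_self hn hk

/-! ### Special systems -/

theorem residual_fst {n : ℕ} (hn : n + 1 ≤ 3) (D : DivisorClass n) (N : Fin 3 → ℤ) :
    (D - ∑ k, N k • lineClass n hn k).1 = D.1 - ∑ k, N k := by
  simp [lineClass, Prod.fst_sum]

theorem two_mul_virtualDim_residual {n : ℕ} (hn : n + 1 ≤ 3) (D : DivisorClass n) {N : Fin 3 → ℤ}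
    (hN : ∀ k, N k ≠ 0 → JoinsBasePoints n k) :
    2 * virtualDim (D - ∑ k, N k • lineClass n hn k) =
      (D.1 - ∑ k, N k) * (D.1 - ∑ k, N k + 3) -
        ∑ j, (extendZero D.2 j - (∑ k, N k - N j)) *
          (extendZero D.2 j - (∑ k, N k - N j) + 1) := by
  rw [two_mul_virtualDim, residual_fst]
  congr 1
  have h : extendZero (D - ∑ k, N k • lineClass n hn k).2 =
      fun j => extendZero D.2 j - (∑ k, N k - N j) := by
    funext j
    by_cases hj : (j : ℕ) < n + 1
    · simp only [extendZero, hj, dite_true, lineClass, Prod.snd_sub, Prod.snd_sum, Prod.smul_snd,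
        Pi.sub_apply, Finset.sum_apply, Pi.smul_apply]
      fin_cases j <;> simp [Fin.sum_univ_three, Fin.ext_iff] <;> ring
    -- Any line but the `j`-th passes through the missing point `j`, so it is not removed and the
    -- multiplicity there stays 0.
    · have h0 (k) (hk : k ≠ j) : N k = 0 := by
        by_contra h
        exact hj (hN k h j hk.symm)
      have : ∑ k, N k = N j := Finset.sum_eq_single j (fun k _ hk => h0 k hk) (by simp)
      simp [extendZero, hj, this]
  have h2 := sum_extendZero hn (D - ∑ k, N k • lineClass n hn k).2 (fun x => x * (x + 1)) (by simp)
  rw [← h2, h]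

theorem inter_lineClass {n : ℕ} (hn : n + 1 ≤ 3) (d : ℕ) (m : Fin (n + 1) → ℕ) (k : Fin 3) :
    inter (systemClass d m) (lineClass n hn k) =
      d - (∑ j, ((extendZero m j : ℕ) : ℤ) - (extendZero m k : ℕ)) := by
  obtain rfl | rfl | rfl : n = 0 ∨ n = 1 ∨ n = 2 := by omega
  all_goals
    fin_cases k <;>
      simp [inter, systemClass, lineClass, extendZero, Fin.sum_univ_succ] <;> ring

theorem extendZero_systemClass {n : ℕ} (d : ℕ) (m : Fin (n + 1) → ℕ) (j : Fin 3) :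
    extendZero (systemClass d m).2 j = (extendZero m j : ℕ) := by
  simp only [extendZero, systemClass]
  split_ifs <;> simp

/-- The residual virtual dimension in terms of the extended multiplicities. -/
theorem two_mul_virtualDim_systemClass_residual {n : ℕ} (hn : n + 1 ≤ 3) (d : ℕ)
    (m : Fin (n + 1) → ℕ) {N : Fin 3 → ℤ} (hN : ∀ k, N k ≠ 0 → JoinsBasePoints n k) :
    2 * virtualDim (systemClass d m - ∑ k, N k • lineClass n hn k) =
      ((d : ℤ) - ∑ k, N k) * ((d : ℤ) - ∑ k, N k + 3) -
        ∑ j, (((extendZero m j : ℕ) : ℤ) - (∑ k, N k - N j)) *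
          (((extendZero m j : ℕ) : ℤ) - (∑ k, N k - N j) + 1) := by
  rw [two_mul_virtualDim_residual hn _ hN]
  simp only [extendZero_systemClass]
  rfl

theorem two_mul_virtualDim_systemClass {n : ℕ} (hn : n + 1 ≤ 3) (d : ℕ) (m : Fin (n + 1) → ℕ) :
    2 * virtualDim (systemClass d m) =
      (d : ℤ) * (d + 3) - ∑ j, ((extendZero m j : ℕ) : ℤ) * ((extendZero m j : ℕ) + 1) := by
  simpa using two_mul_virtualDim_systemClass_residual hn d m (N := 0) (by simp)

section BasePoints

variable {n : ℕ} (hn : n + 1 ≤ 3) (p : Fin (n + 1) → Plane)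
  (b : Module.Basis (Fin 3) ℂ (Fin 3 → ℂ)) (hb : ∀ j, b (Fin.castLE hn j) = (p j).rep)

include hb in
-- Since (-1)-curves are coordinate lines up to units, a family of distinct ones amounts to
-- multiplicities on the three lines, 0 marking a line outside the family.
theorem isNegOneSpecial_iff (d : ℕ) (m : Fin (n + 1) → ℕ) :
    IsNegOneSpecial p d m ↔ ∃ N : Fin 3 →₀ ℕ,
      (∀ k, N k ≠ 0 → JoinsBasePoints n k) ∧
      (∀ k, N k ≠ 0 → (N k : ℤ) = ∑ j, ((extendZero m j : ℕ) : ℤ) - (extendZero m k : ℕ) - d) ∧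
      (∃ k, 2 ≤ N k) ∧
      0 ≤ (systemClass d m - ∑ k, (N k : ℤ) • lineClass n hn k).1 ∧
      0 ≤ virtualDim (systemClass d m - ∑ k, (N k : ℤ) • lineClass n hn k) := by
  constructor
  · rintro ⟨t, A, N, hA, hne, hN, hN1, ⟨i₀, hi₀⟩, hdeg, hv⟩
    choose κ hκ hass using fun i => (hA i).exists_associated hn p b hb
    have hinj : Function.Injective κ := by
      intro i j hij
      by_contra h
      exact hne i j h ((hass i).trans (hij ▸ (hass j).symm))
    have hcls (i) := strictTransformClass_of_associated hn p b hb (hass i)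
    set N' : Fin 3 →₀ ℕ :=
      Finsupp.equivFunOnFinite.symm fun k => ∑ i, if κ i = k then (N i).toNat else 0 with hN'
    have hNκ (i) : (N' (κ i) : ℤ) = N i := by
      have h1 : N' (κ i) = (N i).toNat := by simp [hN', hinj.eq_iff]
      rw [h1, Int.toNat_of_nonneg (by linarith [hN1 i])]
    have hmem (k) (hk : N' k ≠ 0) : ∃ i, κ i = k := by
      by_contra! h
      exact hk (by simp [hN', h])
    have hsum : ∑ i, N i • strictTransformClass p (A i) =
        ∑ k, (N' k : ℤ) • lineClass n hn k := by
      rw [← Finset.sum_subset (Finset.subset_univ (Finset.univ.map ⟨κ, hinj⟩))]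
      · rw [Finset.sum_map]
        exact Finset.sum_congr rfl fun i _ => by
          rw [Function.Embedding.coeFn_mk, hNκ, hcls]
      · intro k _ hk
        have : N' k = 0 := by
          by_contra h
          obtain ⟨i, rfl⟩ := hmem k h
          simp at hk
        simp [this]
    rw [hsum] at hdeg hv
    refine ⟨N', fun k hk => ?_, fun k hk => ?_, ⟨κ i₀, by have := hNκ i₀; omega⟩, hdeg, hv⟩
    · obtain ⟨i, rfl⟩ := hmem k hk
      exact hκ i
    · obtain ⟨i, rfl⟩ := hmem k hk
      have := hN i
      rw [hcls, inter_lineClass] at this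
      rw [hNκ]
      linarith
  · rintro ⟨N, hN, hN', ⟨k₀, hk₀⟩, hdeg, hv⟩
    set e := N.support.equivFin.symm
    have hcls (k) := strictTransformClass_of_associated hn p b hb (Associated.refl (coordForm b k))
    have hsum : ∑ i, (N (e i) : ℤ) • strictTransformClass p (coordForm b (e i)) =
        ∑ k, (N k : ℤ) • lineClass n hn k := by
      simp only [hcls]
      rw [e.sum_comp (fun k : N.support => (N k : ℤ) • lineClass n hn k),
        Finset.sum_coe_sort N.support fun k => (N k : ℤ) • lineClass n hn k]
      exact Finset.sum_subset (Finset.subset_univ _) fun k _ hk => by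
        simp [Finsupp.notMem_support_iff.mp hk]
    have hpos (i) : N (e i) ≠ 0 := Finsupp.mem_support_iff.mp (e i).2
    refine ⟨_, fun i => coordForm b (e i), fun i => (N (e i) : ℤ), fun i => ?_, fun i j hij h => ?_,
      fun i => ?_, fun i => ?_, ⟨e.symm ⟨k₀, Finsupp.mem_support_iff.mpr (by omega)⟩, ?_⟩, ?_, ?_⟩
    · exact isNegOneCurve_coordForm hn p b hb (hN _ (hpos i))
    · have h1 := h.map (coordChange b : Form →* Form)
      simp only [MonoidHom.coe_coe, coordChange_coordForm] at h1
      have h2 := X_dvd_X.mp h1.dvd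
      exact hij (e.injective (Subtype.ext h2))
    · rw [hcls, inter_lineClass]
      have := hN' _ (hpos i)
      linarith
    · exact Int.natCast_pos.mpr (Nat.pos_of_ne_zero (hpos i))
    · simpa using hk₀
    · rwa [hsum]
    · rwa [hsum]

include hb in
theorem isSpecial_iff_isNegOneSpecial (d : ℕ) (m : Fin (n + 1) → ℕ) :
    IsSpecial p d m ↔ IsNegOneSpecial p d m := by
  rw [isNegOneSpecial_iff hn p b hb, IsSpecial, expectedDim, dimension,
    finrank_linearSystem hn p b hb]
  have hv := two_mul_virtualDim_systemClass hn d m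
  constructor
  · intro h
    rw [max_lt_iff] at h
    have hne : (latticePoints d (extendZero m)).Nonempty := by
      rw [← Finset.card_pos]; omega
    obtain ⟨s, hs⟩ := id hne
    obtain ⟨hs1, hs2⟩ := mem_latticePoints.mp hs
    set N := fixedMultiplicity d (extendZero m) with hN
    obtain ⟨hdeg, hcard⟩ := two_mul_card_eq_residual hne N hN
    have hNk (k) : N k = extendZero m 0 + extendZero m 1 + extendZero m 2 - extendZero m k - d :=
      rfl
    have hle (j) : extendZero m j ≤ d := by have := hs2 j; omega
    -- On a line through a missing point, N_k would be at most m_i - d, which is not positive for a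
    -- nonempty system.
    have hadm (k) (hk : N k ≠ 0) : JoinsBasePoints n k := by
      intro j hj
      by_contra hjn
      have hj0 : extendZero m j = 0 := by simp [extendZero, hjn]
      have := hNk k
      have := hle 0
      have := hle 1
      have := hle 2
      fin_cases j <;> fin_cases k <;> simp at * <;> omega
    have hNeq (k) (hk : N k ≠ 0) :
        (N k : ℤ) = ∑ j, ((extendZero m j : ℕ) : ℤ) - (extendZero m k : ℕ) - d := by
      have := hNk k
      rw [Fin.sum_univ_three]
      omega
    have hv' := two_mul_virtualDim_systemClass_residual hn d m (N := fun k => (N k : ℤ))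
      fun k hk => hadm k (by exact_mod_cast hk)
    have hdiff := residual_sub_eq (d := d) (m := fun j => ((extendZero m j : ℕ) : ℤ))
      (N := fun k => (N k : ℤ)) fun k => by
        by_cases hk : N k = 0
        · exact Or.inl (by simp [hk])
        · exact Or.inr (hNeq k hk)
    refine ⟨N, hadm, hNeq, ?_, ?_, ?_⟩
    -- If all N_k ≤ 1, the removal leaves v unchanged, so the dimension equals v and the system is
    -- not special.
    · by_contra! hlt
      have h0 : ∑ k, (N k : ℤ) * (N k - 1) = 0 := Finset.sum_eq_zero fun k _ => by
        have := hlt k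
        interval_cases N k <;> simp
      omega
    · rw [residual_fst, Fin.sum_univ_three]
      simp only [systemClass]
      omega
    · have := Finset.card_pos.mpr hne
      omega
  · rintro ⟨N, hadm, hNeq, ⟨k₀, hk₀⟩, hdeg, hpos⟩
    rw [residual_fst, Fin.sum_univ_three] at hdeg
    simp only [systemClass] at hdeg
    have hcard := le_two_mul_card_of_residual (m := extendZero m) N (d := d) (by omega)
    have hv' := two_mul_virtualDim_systemClass_residual hn d m (N := fun k => (N k : ℤ))
      fun k hk => hadm k (by exact_mod_cast hk)
    have hdiff := residual_sub_eq (d := d) (m := fun j => ((extendZero m j : ℕ) : ℤ))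
      (N := fun k => (N k : ℤ)) fun k => by
        by_cases hk : N k = 0
        · exact Or.inl (by simp [hk])
        · exact Or.inr (hNeq k hk)
    -- Some N_k ≥ 2 makes v(M) > v(L); the dimension is at least v(M) ≥ 0, hence above both terms of
    -- the maximum.
    have h0 : 0 < ∑ k, (N k : ℤ) * (N k - 1) := by
      refine Finset.sum_pos' (fun k _ => ?_) ⟨k₀, Finset.mem_univ _, ?_⟩
      · rcases Nat.eq_zero_or_pos (N k) with h | h
        · simp [h]
        · exact mul_nonneg (by omega) (by omega)
      · exact mul_pos (by omega) (by omega)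
    rw [max_lt_iff]
    constructor <;> omega

end BasePoints

end PlaneCurves

end

theorem mainTheorem7 (n d m₀ m : ℕ) (hn : n ≤ 2)
    (p : Fin (n + 1) → PlaneCurves.Plane) (hp : Projectivization.Independent p) :
    PlaneCurves.IsSpecial p d (PlaneCurves.quasiHomogeneous n m₀ m) ↔
      PlaneCurves.IsNegOneSpecial p d (PlaneCurves.quasiHomogeneous n m₀ m) := by
  obtain ⟨b, hb⟩ := PlaneCurves.exists_basis_extending (by omega)
    (Projectivization.independent_iff.mp hp)
  exact PlaneCurves.isSpecial_iff_isNegOneSpecial (by omega) p b hb d _
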